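/- **Theorem 1.5.** Let $R$ be a commutative Noetherian local ring, let $M$ be a non-zero finitely generated $R$-module of (Krull) dimension $n$, and let $\mathfrak a \subseteq \mathfrak b$ be proper ideals of $R$. For an ideal $\mathfrak c$ of $R$ write $H^i_{\mathfrak c}(M)$ for the $i$-th local cohomology module, that is, the $i$-th right derived functor of $\Gamma_{\mathfrak c}(-) = \bigcup_{j>0} (0 :_{-} \mathfrak c^{j})$ evaluated at $M$. Then there exists an epimorphism of $R$-modules $$H^n_{\mathfrak b}(M) \longrightarrow H^n_{\mathfrak a}(M).$$ (When $\mathfrak b$ is the maximal ideal of $R$, this is the existence of Hartshorne's epimorphism.) -/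

import Mathlib

universe u

open CategoryTheory

namespace TopLocalCohomology

variable {R : Type u} [CommRing R]

/-- The `a`-torsion functor `Γ_a` on `R`-modules: it sends `M` to the submodule
`⋃ i, (0 :_M a ^ i)` of elements killed by some power of `a`, and a linear map to its restriction. -/
def torsionFunctor (a : Ideal R) : ModuleCat.{u} R ⥤ ModuleCat.{u} R where
  obj M := ModuleCat.of R (a.primaryComponent M)
  map f := ModuleCat.ofHom (Ideal.primaryComponent.map a f.hom)

instance (a : Ideal R) : (torsionFunctor a).Additive where

/-- Membership in `Γ_a(M)`, with positive exponents. -/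
theorem mem_torsion_iff (a : Ideal R) (M : ModuleCat.{u} R) (x : M) :
    x ∈ a.primaryComponent M ↔ ∃ i : ℕ, 0 < i ∧ ∀ r ∈ a ^ i, r • x = 0 := by
  rw [Ideal.primaryComponent_mem]
  constructor
  · rintro ⟨i, hi⟩
    refine ⟨i + 1, i.succ_pos, fun r hr => ?_⟩
    exact (Submodule.mem_torsionBySet_iff _ _).1 hi ⟨r, Ideal.pow_le_pow_right i.le_succ hr⟩
  · rintro ⟨i, -, hi⟩
    exact ⟨i, (Submodule.mem_torsionBySet_iff _ _).2 fun r => hi r r.2⟩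

/-- The local cohomology module `H^i_a(M)`: the value at `M` of the `i`-th right derived functor
of the `a`-torsion functor. -/
noncomputable def H (a : Ideal R) (i : ℕ) (M : Type u) [AddCommGroup M] [Module R M] :
    ModuleCat.{u} R :=
  ((torsionFunctor a).rightDerived i).obj (ModuleCat.of R M)

end TopLocalCohomology

open CategoryTheory
open scoped Pointwise

/-! The inclusion `Γ_b ⊆ Γ_a` induces the epimorphism. On an injective resolution `I` of `M`,
surjectivity means that each `n`-cocycle `z` of `Γ_a(I)` becomes `b`-torsion after subtracting a
boundary of `Γ_a(I)`. Adding generators of `b` one at a time reduces this to passing from `a` to `a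
+ (x)` with `x` in the maximal ideal.

Primes of the support avoiding `x` form a set of dimension `< n`, so a Grothendieck-type vanishing
(`extPowTorsion_of_krullDim_supportAway_lt`) makes `H^n_a(M)` `x`-power torsion: for `n > 0`, `x^k z
= d w` with `w` in `Γ_a(I^(n-1))`. That module is again injective (`injective_primaryComponent`),
hence surjects onto its localization at `x`: `w = x^k w'` up to `x`-power torsion. Then `z - d w'`
is killed by a power of `x`.

The vanishing is proved on `colim_j Ext^i(R/a^j, M)`: after removing `Γ_a(M)`, dividing by a regular
`r ∈ a` lowers dimension and degree together. -/

namespace TopLocalCohomology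

/-! ### Torsion submodules and regular elements -/

section Torsion

variable {R : Type*} [CommRing R] {M : Type*} [AddCommGroup M] [Module R M]

theorem mem_primaryComponent {a : Ideal R} {x : M} :
    x ∈ a.primaryComponent M ↔ ∃ i : ℕ, ∀ r ∈ a ^ i, r • x = 0 := by
  rw [Ideal.primaryComponent_mem]
  simp [Submodule.mem_torsionBySet_iff]

theorem primaryComponent_anti {a b : Ideal R} (h : a ≤ b) :
    b.primaryComponent M ≤ a.primaryComponent M := fun x hx => by
  obtain ⟨i, hi⟩ := mem_primaryComponent.1 hx
  exact mem_primaryComponent.2 ⟨i, fun r hr => hi r (Ideal.pow_right_mono h i hr)⟩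

/-- By pigeonhole, `(a + (x))^(s+k) ⊆ a^s + (x^k)`. -/
theorem mem_primaryComponent_sup_span {a : Ideal R} {x : R} {k : ℕ} {y : M}
    (hy : y ∈ a.primaryComponent M) (hx : x ^ k • y = 0) :
    y ∈ (a ⊔ Ideal.span {x}).primaryComponent M := by
  obtain ⟨s, hs⟩ := mem_primaryComponent.1 hy
  refine mem_primaryComponent.2 ⟨s + k, fun r hr => ?_⟩
  obtain ⟨c, hc, d, hd, rfl⟩ := Submodule.mem_sup.1 (Ideal.sup_pow_add_le_pow_sup_pow hr)
  rw [Ideal.span_singleton_pow, Ideal.mem_span_singleton'] at hd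
  obtain ⟨d, rfl⟩ := hd
  rw [add_smul, hs c hc, mul_smul, hx, smul_zero, add_zero]

/-- A finitely generated module of `a`-torsion elements is killed by a power of `a`. -/
theorem exists_pow_smul_eq_zero_of_fg {a : Ideal R} {N : Submodule R M} (hN : N.FG)
    (h : N ≤ a.primaryComponent M) : ∃ s : ℕ, ∀ r ∈ a ^ s, ∀ y ∈ N, r • y = 0 := by
  induction N, hN using Submodule.fg_induction with
  | singleton x =>
    obtain ⟨s, hs⟩ := mem_primaryComponent.1 (h (Submodule.mem_span_singleton_self x))
    refine ⟨s, fun r hr y hy => ?_⟩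
    obtain ⟨c, rfl⟩ := Submodule.mem_span_singleton.1 hy
    rw [smul_comm, hs r hr, smul_zero]
  | sup N₁ N₂ _ _ h₁ h₂ =>
    obtain ⟨s, hs⟩ := h₁ (le_sup_left.trans h)
    obtain ⟨t, ht⟩ := h₂ (le_sup_right.trans h)
    refine ⟨s + t, fun r hr y hy => ?_⟩
    obtain ⟨y₁, hy₁, y₂, hy₂, rfl⟩ := Submodule.mem_sup.1 hy
    rw [smul_add, hs r (Ideal.pow_le_pow_right (Nat.le_add_right s t) hr) y₁ hy₁,
      ht r (Ideal.pow_le_pow_right (Nat.le_add_left t s) hr) y₂ hy₂, add_zero]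

/-- If `a^i y` is `a`-torsion, it is finitely generated because `R` is noetherian, so a single power
`a^s` kills it and `a^(s+i)` kills `y`. -/
theorem primaryComponent_quotient_primaryComponent [IsNoetherianRing R] (a : Ideal R) :
    a.primaryComponent (M ⧸ a.primaryComponent M) = ⊥ := by
  refine (Submodule.eq_bot_iff _).2 fun y hy => ?_
  obtain ⟨y, rfl⟩ := Submodule.Quotient.mk_surjective _ y
  obtain ⟨i, hi⟩ := mem_primaryComponent.1 hy
  have hfg : (Submodule.map (LinearMap.toSpanSingleton R M y) (a ^ i)).FG :=
    (IsNoetherian.noetherian (a ^ i)).map _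
  obtain ⟨s, hs⟩ := exists_pow_smul_eq_zero_of_fg hfg (a := a) (by
    rintro _ ⟨r, hr, rfl⟩
    rw [← Submodule.Quotient.mk_eq_zero]
    exact hi r hr)
  rw [Submodule.Quotient.mk_eq_zero]
  refine mem_primaryComponent.2 ⟨s + i, fun r hr => ?_⟩
  rw [pow_add] at hr
  refine Submodule.mul_induction_on hr (fun c hc d hd => ?_) (fun c d hc hd => ?_)
  · rw [mul_smul]
    exact hs c hc _ ⟨d, hd, rfl⟩
  · rw [add_smul, hc, hd, add_zero]

/-- A finitely generated module without `a`-torsion has a regular element in `a`. -/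
theorem exists_isSMulRegular_of_primaryComponent_eq_bot [IsNoetherianRing R] [Module.Finite R M]
    {a : Ideal R} (h : a.primaryComponent M = ⊥) : ∃ r ∈ a, IsSMulRegular M r := by
  by_contra! hcon
  have hsub : (a : Set R) ⊆ ⋃ p ∈ associatedPrimes R M, p := by
    rw [biUnion_associatedPrimes_eq_zero_divisors]
    intro r hr
    have := hcon r hr
    rw [isSMulRegular_iff_right_eq_zero_of_smul] at this
    push Not at this
    obtain ⟨x, hx, hx0⟩ := this
    exact ⟨x, hx0, hx⟩
  -- Prime avoidance over the finitely many associated primes.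
  obtain ⟨p, hp, hap⟩ := (a.subset_union_prime_finite (associatedPrimes.finite R M) (f := id) 0 0
    fun _ h _ _ => h.1).1 hsub
  rw [AssociatedPrimes.mem_iff, isAssociatedPrime_iff] at hp
  obtain ⟨hprime, x, rfl⟩ := hp
  have hx : x ∈ a.primaryComponent M := mem_primaryComponent.2 ⟨1, fun r hr => by
    have := hap (by simpa using hr)
    simpa [Submodule.mem_colon_singleton] using this⟩
  rw [h, Submodule.mem_bot] at hx
  exact hprime.ne_top (by simp [hx, Ideal.eq_top_iff_one, Submodule.mem_colon_singleton])

end Torsion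

/-! ### Injective modules over a noetherian ring -/

section Injective

variable {R : Type u} [CommRing R] [IsNoetherianRing R] {I : Type u} [AddCommGroup I] [Module R I]

/-- The `a`-torsion submodule of an injective module over a noetherian ring is injective. -/
theorem injective_primaryComponent (a : Ideal R) [Module.Injective R I] :
    Module.Injective R (a.primaryComponent I) := by
  refine Module.Baer.injective fun K f => ?_
  let T := a.primaryComponent I
  have hfg : (LinearMap.range (T.subtype ∘ₗ f)).FG := Module.Finite.iff_fg.1 inferInstance
  obtain ⟨s, hs⟩ := exists_pow_smul_eq_zero_of_fg hfg (a := a) (by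
    rintro _ ⟨y, rfl⟩
    exact (f y).2)
  -- Artin–Rees: `a^(s+c) ∩ K ⊆ a^s K`, which `f` kills. Hence `f` factors through the image of `K`
  -- in `R/a^(s+c)`, and any extension from there to `I` has `a`-torsion values.
  obtain ⟨c, hc⟩ := a.exists_pow_inf_eq_pow_smul (M := R) K
  have hAR : ∀ y : K, (y : R) ∈ a ^ (s + c) → f y = 0 := by
    intro y hy
    have h1 : (y : R) ∈ a ^ s • K := by
      have h2 := hc (s + c) (Nat.le_add_left c s)
      have h3 : (y : R) ∈ a ^ (s + c) • (⊤ : Submodule R R) ⊓ K :=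
        ⟨by simpa using hy, y.2⟩
      rw [h2, Nat.add_sub_cancel] at h3
      exact Submodule.smul_mono le_rfl inf_le_right h3
    have h4 : ∀ z (hz : z ∈ a ^ s • K), f ⟨z, Submodule.smul_le_right hz⟩ = 0 := by
      intro z hz
      refine Submodule.smul_induction_on' (p := fun z hz => f ⟨z, Submodule.smul_le_right hz⟩ = 0)
        hz (fun r hr n hn => ?_) (fun z₁ h₁ z₂ h₂ e₁ e₂ => ?_)
      · have : f ⟨r • n, K.smul_mem r hn⟩ = r • f ⟨n, hn⟩ := by rw [← map_smul]; rfl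
        rw [this]
        exact Subtype.ext (hs r hr _ ⟨⟨n, hn⟩, rfl⟩)
      · have := map_add f ⟨z₁, Submodule.smul_le_right h₁⟩ ⟨z₂, Submodule.smul_le_right h₂⟩
        rw [e₁, e₂, add_zero] at this
        exact this
    exact h4 y h1
  let q : K →ₗ[R] R ⧸ a ^ (s + c) := (Submodule.mkQ (a ^ (s + c))) ∘ₗ K.subtype
  have hq : LinearMap.ker q ≤ LinearMap.ker (T.subtype ∘ₗ f) := by
    intro y hy
    have : (y : R) ∈ a ^ (s + c) := by
      exact Ideal.Quotient.eq_zero_iff_mem.1 hy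
    simp [hAR y this]
  obtain ⟨g, hg⟩ := Module.Injective.out ((LinearMap.ker q).liftQ q le_rfl)
    (LinearMap.ker_eq_bot.1 (Submodule.ker_liftQ_eq_bot _ _ _ le_rfl))
    ((LinearMap.ker q).liftQ (T.subtype ∘ₗ f) hq)
  refine ⟨LinearMap.codRestrict T (g ∘ₗ Submodule.mkQ (a ^ (s + c))) fun r => ?_, fun r hr => ?_⟩
  · refine mem_primaryComponent.2 ⟨s + c, fun d hd => ?_⟩
    rw [LinearMap.comp_apply, ← map_smul, ← map_smul]
    have : Submodule.mkQ (a ^ (s + c)) (d • r) = 0 := by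
      rw [Submodule.mkQ_apply, Submodule.Quotient.mk_eq_zero]
      exact Ideal.mul_mem_right r _ hd
    rw [this, map_zero]
  · exact Subtype.ext (hg (Submodule.Quotient.mk ⟨r, hr⟩))

/-- Over a noetherian ring, an injective module surjects onto its localization at an element. -/
theorem exists_pow_smul_sub_pow_smul_eq_zero [Module.Injective R I]
    (x : R) (k : ℕ) (w : I) : ∃ (w' : I) (m : ℕ), x ^ m • (w - x ^ k • w') = 0 := by
  -- Once the annihilators of `x^i` stabilize at `m`, the map `x^(m+k) r ↦ r x^m w` is well defined
  -- on `(x^(m+k))`; its extension to `R` sends `1` to `w'`.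
  let L : ℕ →o Submodule R R :=
    ⟨fun i => LinearMap.ker (LinearMap.mulLeft R (x ^ i)), monotone_nat_of_le_succ fun i r hr => by
      simp only [LinearMap.mem_ker, LinearMap.mulLeft_apply] at hr ⊢
      rw [pow_succ', mul_assoc, hr, mul_zero]⟩
  obtain ⟨m, hm⟩ := monotone_stabilizes_iff_noetherian.2 ‹IsNoetherianRing R› L
  let φ := LinearMap.mulLeft R (x ^ (m + k))
  have hφ : LinearMap.ker φ ≤ LinearMap.ker (LinearMap.toSpanSingleton R I (x ^ m • w)) := by
    intro r hr
    have : r ∈ L m := by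
      rw [hm (m + k) (Nat.le_add_right m k)]
      exact hr
    have h0 : x ^ m * r = 0 := this
    rw [LinearMap.mem_ker, LinearMap.toSpanSingleton_apply, smul_smul, mul_comm, h0, zero_smul]
  obtain ⟨g, hg⟩ := Module.Injective.out ((LinearMap.ker φ).liftQ φ le_rfl)
    (LinearMap.ker_eq_bot.1 (Submodule.ker_liftQ_eq_bot _ _ _ le_rfl))
    ((LinearMap.ker φ).liftQ _ hφ)
  refine ⟨g 1, m, ?_⟩
  have h1 : g (x ^ (m + k) * 1) = (1 : R) • x ^ m • w := hg (Submodule.Quotient.mk 1)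
  rw [smul_sub, smul_smul, ← pow_add, ← map_smul, smul_eq_mul, h1, one_smul, sub_self]

end Injective

/-! ### Dimension of the support away from `x` -/

section Support

variable {R : Type*} [CommRing R] {M : Type*} [AddCommGroup M] [Module R M]

/-- The primes in the support of `M` that do not contain `x`. -/
def supportAway (x : R) (M : Type*) [AddCommGroup M] [Module R M] : Set (PrimeSpectrum R) :=
  {p | p ∈ Module.support R M ∧ x ∉ p.asIdeal}

theorem krullDim_supportAway_mono {N : Type*} [AddCommGroup N] [Module R N] (x : R)
    (h : Module.support R N ⊆ Module.support R M) :
    Order.krullDim (supportAway x N) ≤ Order.krullDim (supportAway x M) :=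
  Order.krullDim_le_of_strictMono (fun p => ⟨p.1, h p.2.1, p.2.2⟩) fun _ _ h => h

/-- Dividing by a regular element lowers the dimension of the part of the support where `x` is
invertible. -/
theorem krullDim_supportAway_quotSMulTop_lt [IsNoetherianRing R] [Module.Finite R M]
    {r : R} (hr : IsSMulRegular M r) (x : R) {d : ℕ}
    (h : Order.krullDim (supportAway x M) < (d + 1 : ℕ)) :
    Order.krullDim (supportAway x (QuotSMulTop r M)) < (d : ℕ) := by
  rw [Order.krullDim_lt_coe_iff] at h ⊢
  intro p
  have hp := p.head.2.1
  simp only [Module.support_quotSMulTop, Set.mem_inter_iff, PrimeSpectrum.mem_zeroLocus,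
    Set.singleton_subset_iff] at hp
  have hsub : Module.support R (QuotSMulTop r M) ⊆ Module.support R M := by simp
  let q : LTSeries (supportAway x M) :=
    p.map (fun p => ⟨p.1, hsub p.2.1, p.2.2⟩) fun _ _ h => h
  -- A minimal prime below the head of the chain is associated, so it omits the regular element `r`
  -- and lengthens the chain by one.
  obtain ⟨P, hPmin, hP⟩ := Ideal.exists_minimalPrimes_le (Module.mem_support_iff_of_finite.1 hp.1)
  have := hPmin.isPrime
  let P' : supportAway x M := ⟨⟨P, hPmin.isPrime⟩, Module.mem_support_iff_of_finite.2 hPmin.1.2,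
    fun hx => p.head.2.2 (hP hx)⟩
  have hlt : P' < q.head := by
    refine lt_of_le_of_ne hP fun h => ?_
    have hrP : r ∈ P := by
      have h2 : P = p.head.1.asIdeal := congrArg (fun t => t.1.asIdeal) h
      rw [h2]
      exact hp.2
    have hass : P ∈ associatedPrimes R M :=
      Module.associatedPrimes.minimalPrimes_annihilator_subset_associatedPrimes R M hPmin
    have : r ∈ ⋃ p ∈ associatedPrimes R M, (p : Set R) := Set.mem_biUnion hass hrP
    rw [biUnion_associatedPrimes_eq_zero_divisors] at this
    obtain ⟨y, hy0, hy⟩ := this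
    exact hy0 (hr (by simpa using hy))
  have := h (q.cons P' hlt)
  simp [q] at this
  exact this

/-- If `x` lies in every prime of the support, then a power of `x` kills `M`. -/
theorem exists_pow_smul_eq_zero_of_krullDim_supportAway_lt [Module.Finite R M] {x : R}
    (h : Order.krullDim (supportAway x M) < (0 : ℕ)) : ∃ m : ℕ, ∀ y : M, x ^ m • y = 0 := by
  rw [Order.krullDim_lt_coe_iff] at h
  have hx : x ∈ (Module.annihilator R M).radical := by
    rw [Ideal.radical_eq_sInf, Submodule.mem_sInf]
    rintro P ⟨hP, hprime⟩
    by_contra hxP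
    exact absurd (h (RelSeries.singleton _ ⟨⟨P, hprime⟩,
      Module.mem_support_iff_of_finite.2 hP, hxP⟩)) (Nat.not_lt_zero _)
  obtain ⟨m, hm⟩ := hx
  exact ⟨m, Module.mem_annihilator.1 hm⟩

/-- A chain of primes avoiding `x` can always be extended by the maximal ideal. -/
theorem krullDim_supportAway_lt [IsLocalRing R] {n : ℕ} (h : Module.supportDim R M = n)
    {x : R} (hx : x ∈ IsLocalRing.maximalIdeal R) :
    Order.krullDim (supportAway x M) < (n : ℕ) := by
  rw [Order.krullDim_lt_coe_iff]
  intro p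
  let q : LTSeries (Module.support R M) := p.map (fun p => ⟨p.1, p.2.1⟩) fun _ _ h => h
  let m : Module.support R M := ⟨IsLocalRing.closedPoint R,
    Module.mem_support_mono (IsLocalRing.le_maximalIdeal p.head.1.2.ne_top) p.head.2.1⟩
  have hlt : q.last < m := by
    refine lt_of_le_of_ne (IsLocalRing.le_maximalIdeal q.last.1.2.ne_top) fun h => ?_
    apply p.last.2.2
    have h2 : p.last.1 = IsLocalRing.closedPoint R := congrArg (fun t => t.1) h
    rw [h2]
    exact hx
  have := Order.LTSeries.length_le_krullDim (q.snoc m hlt)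
  rw [← Module.supportDim, h] at this
  simp [q] at this
  exact_mod_cast this

end Support

/-! ### Vanishing through `colim_j Ext^i(R/a^j, M)` -/

section Ext

open Abelian

variable {R : Type u} [CommRing R]

/-- The projection `R ⧸ a ^ k ⟶ R ⧸ a ^ j` for `j ≤ k`. -/
def quotPowMap (a : Ideal R) {j k : ℕ} (h : j ≤ k) :
    ModuleCat.of R (R ⧸ a ^ k) ⟶ ModuleCat.of R (R ⧸ a ^ j) :=
  ModuleCat.ofHom (Submodule.factor (Ideal.pow_le_pow_right h))

theorem quotPowMap_comp (a : Ideal R) {j k l : ℕ} (h : j ≤ k) (h' : k ≤ l) :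
    quotPowMap a h' ≫ quotPowMap a h = quotPowMap a (h.trans h') := by
  ext
  rfl

/-- The pullback `Ext^i(R/a^j, M) → Ext^i(R/a^k, M)` for `j ≤ k`. -/
noncomputable def extRes (a : Ideal R) {j k : ℕ} (h : j ≤ k) {M : ModuleCat.{u} R} {i : ℕ}
    (e : Ext (ModuleCat.of R (R ⧸ a ^ j)) M i) : Ext (ModuleCat.of R (R ⧸ a ^ k)) M i :=
  (Ext.mk₀ (quotPowMap a h)).comp e (zero_add i)

theorem extRes_smul (a : Ideal R) {j k : ℕ} (h : j ≤ k) {M : ModuleCat.{u} R} {i : ℕ}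
    (r : R) (e : Ext (ModuleCat.of R (R ⧸ a ^ j)) M i) :
    extRes a h (r • e) = r • extRes a h e := by
  simp [extRes]

theorem extRes_zero (a : Ideal R) {j k : ℕ} (h : j ≤ k) (M : ModuleCat.{u} R) (i : ℕ) :
    extRes a h (0 : Ext (ModuleCat.of R (R ⧸ a ^ j)) M i) = 0 := by
  simp [extRes]

theorem extRes_extRes (a : Ideal R) {j k l : ℕ} (h : j ≤ k) (h' : k ≤ l) {M : ModuleCat.{u} R}
    {i : ℕ} (e : Ext (ModuleCat.of R (R ⧸ a ^ j)) M i) :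
    extRes a h' (extRes a h e) = extRes a (h.trans h') e := by
  simp [extRes, ← quotPowMap_comp a h h', ← Ext.mk₀_comp_mk₀_assoc]

theorem extRes_comp (a : Ideal R) {j k : ℕ} (h : j ≤ k) {M N : ModuleCat.{u} R} {i l m : ℕ}
    (e : Ext (ModuleCat.of R (R ⧸ a ^ j)) M i) (f : Ext M N l) (hm : i + l = m) :
    extRes a h (e.comp f hm) = (extRes a h e).comp f hm := by
  rw [extRes, extRes, Ext.comp_assoc _ _ _ (zero_add i) hm (by lia)]

/-- Every class in `colim_j Ext^i(R/a^j, M)` is killed by a power of `x`. -/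
def ExtPowTorsion (a : Ideal R) (x : R) (i : ℕ) (M : ModuleCat.{u} R) : Prop :=
  ∀ (j : ℕ) (e : Ext (ModuleCat.of R (R ⧸ a ^ j)) M i),
    ∃ (k : ℕ) (h : j ≤ k) (m : ℕ), x ^ m • extRes a h e = 0

variable {a : Ideal R} {x : R} {i : ℕ}

theorem ExtPowTorsion.of_shortExact {S : ShortComplex (ModuleCat.{u} R)} (hS : S.ShortExact)
    (h₁ : ExtPowTorsion a x i S.X₁) (h₃ : ExtPowTorsion a x i S.X₃) :
    ExtPowTorsion a x i S.X₂ := by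
  intro j e
  obtain ⟨k, hk, m, hm⟩ := h₃ j (e.comp (Ext.mk₀ S.g) (add_zero i))
  rw [extRes_comp, ← Ext.smul_comp] at hm
  obtain ⟨e₁, he₁⟩ := Ext.covariant_sequence_exact₂ _ hS _ hm
  obtain ⟨l, hl, m', hm'⟩ := h₁ k e₁
  refine ⟨l, hk.trans hl, m' + m, ?_⟩
  rw [pow_add, mul_smul, ← extRes_extRes a hk hl, ← extRes_smul, ← he₁, extRes_comp,
    ← Ext.smul_comp, hm', Ext.zero_comp]

/-- Elements of `a ^ j` kill `Ext^i(R/a^j, M)`. -/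
theorem smul_ext_eq_zero {j : ℕ} {r : R} (hr : r ∈ a ^ j) {M : ModuleCat.{u} R}
    (e : Ext (ModuleCat.of R (R ⧸ a ^ j)) M i) : r • e = 0 := by
  have h : r • 𝟙 (ModuleCat.of R (R ⧸ a ^ j)) = 0 := by
    ext
    change r • (Submodule.Quotient.mk 1 : R ⧸ a ^ j) = 0
    rw [← Submodule.Quotient.mk_smul, Submodule.Quotient.mk_eq_zero]
    exact Ideal.mul_mem_right _ _ hr
  rw [← Ext.mk₀_id_comp e, ← Ext.smul_comp, ← Ext.mk₀_smul, h, Ext.mk₀_zero, Ext.zero_comp]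

theorem ExtPowTorsion.of_pow_smul_eq_zero {M : ModuleCat.{u} R} {m : ℕ}
    (h : ∀ y : M, x ^ m • y = 0) : ExtPowTorsion a x i M := by
  intro j e
  refine ⟨j, le_rfl, m, ?_⟩
  have h : x ^ m • 𝟙 M = 0 := by
    ext y
    exact h y
  rw [Ext.smul_eq_comp_mk₀, h, Ext.mk₀_zero, Ext.comp_zero]

/-- If `r ∈ a` is regular on `M`, the torsion property for `M/rM` in degree `i` gives the one
for `M` in degree `i + 1`. -/
theorem ExtPowTorsion.of_quotSMulTop {M : Type u} [AddCommGroup M] [Module R M] {r : R}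
    (hra : r ∈ a) (hr : IsSMulRegular M r)
    (h : ExtPowTorsion a x i (ModuleCat.of R (QuotSMulTop r M))) :
    ExtPowTorsion a x (i + 1) (ModuleCat.of R M) := by
  let S : ShortComplex (ModuleCat.{u} R) :=
    ShortComplex.mk (r • 𝟙 (ModuleCat.of R M)) 
      (ModuleCat.ofHom (Submodule.mkQ (r • (⊤ : Submodule R M)))) (by
      ext y
      exact (Submodule.Quotient.mk_eq_zero _).2
        (Submodule.smul_mem_pointwise_smul y r ⊤ trivial))
  have hS : S.ShortExact := ModuleCat.shortComplex_shortExact _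
    (fun y => by
      refine (Submodule.Quotient.mk_eq_zero _).trans ?_
      rw [Submodule.mem_smul_pointwise_iff_exists]
      exact ⟨fun ⟨z, _, hz⟩ => ⟨z, hz⟩, fun ⟨z, hz⟩ => ⟨z, trivial, hz⟩⟩)
    hr (Submodule.mkQ_surjective _)
  -- Induction on the power of `r` killing `e`: `r^s e` is killed by `r`, so it comes from `Ext^i`
  -- of `M/rM`, and some multiple `x^m e`, pulled back, is killed by `r^s`.
  have hstep : ∀ (s j : ℕ) (e : Ext (ModuleCat.of R (R ⧸ a ^ j)) S.X₁ (i + 1)), r ^ s • e = 0 →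
      ∃ (k : ℕ) (h : j ≤ k) (m : ℕ), x ^ m • extRes a h e = 0 := by
    intro s
    induction s with
    | zero =>
      intro j e he
      refine ⟨j, le_rfl, 0, ?_⟩
      rw [pow_zero, one_smul] at he
      rw [he, extRes_zero, smul_zero]
    | succ s ih =>
      intro j e he
      have he' : (r ^ s • e).comp (Ext.mk₀ S.f) (add_zero (i + 1)) = 0 := by
        rw [← Ext.smul_eq_comp_mk₀ (r ^ s • e) r, smul_smul, ← pow_succ']
        exact he
      obtain ⟨e₃, he₃⟩ := Ext.covariant_sequence_exact₁ _ hS _ he' rfl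
      obtain ⟨k, hk, m, hm⟩ := h j e₃
      have h0 : r ^ s • (x ^ m • extRes a hk e) = 0 := by
        rw [smul_comm, ← extRes_smul, ← he₃, extRes_comp, ← Ext.smul_comp]
        erw [hm]
        rw [Ext.zero_comp]
      obtain ⟨l, hl, m', hm'⟩ := ih k _ h0
      refine ⟨l, hk.trans hl, m' + m, ?_⟩
      rw [← extRes_extRes a hk hl, pow_add, mul_smul, ← extRes_smul, hm']
  intro j e
  exact hstep j j e (smul_ext_eq_zero (Ideal.pow_mem_pow hra j) e)

/-- An `a`-torsion module embeds in an injective `a`-torsion module. -/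
theorem exists_shortExact_of_torsion [IsNoetherianRing R] {a : Ideal R}
    (N : ModuleCat.{u} R) (hN : ∀ y : N, y ∈ a.primaryComponent N) :
    ∃ S : ShortComplex (ModuleCat.{u} R), S.ShortExact ∧ S.X₁ = N ∧ Injective S.X₂ ∧
      ∀ y : S.X₂, y ∈ a.primaryComponent S.X₂ := by
  let I := Injective.under N
  have hI : Injective I := Injective.injective_under N
  have : Module.Injective R I := (Module.injective_iff_injective_object R I).2 hI
  let J := a.primaryComponent I
  let f : N →ₗ[R] J := LinearMap.codRestrict J (Injective.ι N).hom fun y =>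
    Ideal.primaryComponent_map_mem a (Injective.ι N).hom ⟨y, hN y⟩
  have hf : Function.Injective f := by
    refine Function.Injective.of_comp (f := J.subtype) ?_
    exact (ModuleCat.mono_iff_injective (Injective.ι N)).1 inferInstance
  refine ⟨ModuleCat.shortComplexOfCompEqZero f (LinearMap.range f).mkQ
    (LinearMap.range_mkQ_comp f), ?_, rfl, ?_, ?_⟩
  · exact ModuleCat.shortComplex_shortExact _ (LinearMap.exact_map_mkQ_range f) hf
      (Submodule.mkQ_surjective _)
  · exact (Module.injective_iff_injective_object R J).1 (injective_primaryComponent a)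
  · intro y
    obtain ⟨s, hs⟩ := mem_primaryComponent.1 y.2
    exact mem_primaryComponent.2 ⟨s, fun r hr => Subtype.ext (hs r hr)⟩

/-- For an `a`-torsion module the higher local cohomology vanishes. -/
theorem ExtPowTorsion.of_torsion [IsNoetherianRing R] (a : Ideal R) (x : R) (i : ℕ)
    (N : ModuleCat.{u} R) (hN : ∀ y : N, y ∈ a.primaryComponent N) :
    ExtPowTorsion a x (i + 1) N := by
  induction i generalizing N with
  | zero =>
    obtain ⟨S, hS, rfl, hinj, htors⟩ := exists_shortExact_of_torsion N hN
    intro j e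
    obtain ⟨e₃, rfl⟩ := Ext.covariant_sequence_exact₁ _ hS e (Ext.eq_zero_of_injective _) rfl
    -- Lift `φ(1)` to `y`. A power `a^s` kills `y`, so over `R/a^(max j s)` the map `φ` factors
    -- through `S.g` and its connecting class vanishes.
    obtain ⟨φ, rfl⟩ := Ext.addEquiv₀.symm.surjective e₃
    obtain ⟨y, hy⟩ := hS.moduleCat_surjective_g (φ (Submodule.Quotient.mk 1))
    obtain ⟨s, hs⟩ := mem_primaryComponent.1 (htors y)
    let ψ : ModuleCat.of R (R ⧸ a ^ max j s) ⟶ S.X₂ := ModuleCat.ofHom <|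
      Submodule.liftQ _ (LinearMap.toSpanSingleton R S.X₂ y) fun r hr =>
        hs r (Ideal.pow_le_pow_right (le_max_right j s) hr)
    have hψ : quotPowMap a (le_max_left j s) ≫ φ = ψ ≫ S.g := by
      ext
      change φ (Submodule.Quotient.mk 1) = S.g ((1 : R) • y)
      rw [one_smul, hy]
    refine ⟨max j s, le_max_left j s, 0, ?_⟩
    rw [pow_zero, one_smul, extRes_comp, extRes]
    change ((Ext.mk₀ _).comp (Ext.mk₀ φ) _).comp _ _ = 0
    rw [Ext.mk₀_comp_mk₀, hψ, ← Ext.mk₀_comp_mk₀, Ext.comp_assoc _ _ _ (zero_add 0) (zero_add 1)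
      (by lia), hS.comp_extClass, Ext.comp_zero]
  | succ i ih =>
    obtain ⟨S, hS, rfl, hinj, htors⟩ := exists_shortExact_of_torsion N hN
    intro j e
    obtain ⟨e₃, rfl⟩ := Ext.covariant_sequence_exact₁ _ hS e (Ext.eq_zero_of_injective _) rfl
    obtain ⟨k, hk, m, hm⟩ := ih S.X₃ (fun y => by
      obtain ⟨y, rfl⟩ := hS.moduleCat_surjective_g y
      exact Ideal.primaryComponent_map_mem a S.g.hom ⟨y, htors y⟩) j e₃
    exact ⟨k, hk, m, by rw [extRes_comp, ← Ext.smul_comp, hm, Ext.zero_comp]⟩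

/-- Local cohomology of `M` is `x`-power torsion in degrees above the dimension of the part of
the support of `M` where `x` is invertible. -/
theorem extPowTorsion_of_krullDim_supportAway_lt [IsNoetherianRing R] (a : Ideal R) (x : R)
    (d : ℕ) (M : Type u) [AddCommGroup M] [Module R M] [Module.Finite R M]
    (h : Order.krullDim (supportAway x M) < (d : ℕ)) (i : ℕ) (hi : d ≤ i) :
    ExtPowTorsion a x i (ModuleCat.of R M) := by
  induction d generalizing M i with
  | zero =>
    obtain ⟨m, hm⟩ := exists_pow_smul_eq_zero_of_krullDim_supportAway_lt h
    exact ExtPowTorsion.of_pow_smul_eq_zero (m := m) hm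
  | succ d ih =>
    obtain ⟨i, rfl⟩ : ∃ i', i = i' + 1 := ⟨i - 1, by lia⟩
    let T := a.primaryComponent M
    obtain ⟨r, hra, hr⟩ := exists_isSMulRegular_of_primaryComponent_eq_bot
      (primaryComponent_quotient_primaryComponent (M := M) a)
    have hquot : ExtPowTorsion a x (i + 1) (ModuleCat.of R (M ⧸ T)) :=
      ExtPowTorsion.of_quotSMulTop hra hr <| ih _
        (krullDim_supportAway_quotSMulTop_lt hr x <| (krullDim_supportAway_mono x
          (Module.support_subset_of_surjective T.mkQ T.mkQ_surjective)).trans_lt h) i (by lia)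
    have hsub : ExtPowTorsion a x (i + 1) (ModuleCat.of R T) :=
      ExtPowTorsion.of_torsion a x i _ fun y => by
        obtain ⟨s, hs⟩ := mem_primaryComponent.1 y.2
        exact mem_primaryComponent.2 ⟨s, fun r hr => Subtype.ext (hs r hr)⟩
    exact ExtPowTorsion.of_shortExact
      (S := ModuleCat.shortComplexOfCompEqZero T.subtype T.mkQ (by ext; simp))
      (ModuleCat.shortComplex_shortExact _ (LinearMap.exact_subtype_mkQ T)
        T.injective_subtype T.mkQ_surjective) hsub hquot

end Ext

/-! ### Moving cocycles in an injective resolution -/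

section Resolution

variable {R : Type u} [CommRing R]

/-- A torsion cocycle of an injective resolution is, up to a power of `x`, the boundary of a torsion
element. -/
theorem exists_pow_smul_eq_d {a : Ideal R} {x : R} {i : ℕ} {M : ModuleCat.{u} R}
    (h : ExtPowTorsion a x (i + 1) M) (I : InjectiveResolution M) (z : I.cocomplex.X (i + 1))
    (hz : z ∈ a.primaryComponent (I.cocomplex.X (i + 1)))
    (hd : I.cocomplex.d (i + 1) (i + 2) z = 0) :
    ∃ (m : ℕ) (w : I.cocomplex.X i), w ∈ a.primaryComponent (I.cocomplex.X i) ∧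
      I.cocomplex.d i (i + 1) w = x ^ m • z := by
  obtain ⟨j, hj⟩ := mem_primaryComponent.1 hz
  -- Elements killed by `a^j` are maps out of `R/a^j`, so the cocycle `z` represents an `Ext` class.
  let φ : ModuleCat.of R (R ⧸ a ^ j) ⟶ I.cocomplex.X (i + 1) := ModuleCat.ofHom <|
    Submodule.liftQ _ (LinearMap.toSpanSingleton R _ z) hj
  have hφ : φ ≫ I.cocomplex.d (i + 1) (i + 2) = 0 := by
    ext
    change I.cocomplex.d (i + 1) (i + 2) ((1 : R) • z) = 0
    rw [one_smul, hd]
  obtain ⟨k, hk, m, hm⟩ := h j (I.extMk φ (i + 2) rfl hφ)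
  rw [extRes, ← Abelian.Ext.smul_comp, ← Abelian.Ext.mk₀_smul, I.mk₀_comp_extMk,
    I.extMk_eq_zero_iff _ _ _ _ i rfl] at hm
  obtain ⟨g, hg⟩ := hm
  refine ⟨m, g (Submodule.Quotient.mk 1), mem_primaryComponent.2 ⟨k, fun r hr => ?_⟩, ?_⟩
  · have h0 : r • (Submodule.Quotient.mk 1 : R ⧸ a ^ k) = 0 :=
      (Submodule.Quotient.mk_eq_zero _).2 (Ideal.mul_mem_right _ _ hr)
    exact (map_smul g.hom r _).symm.trans ((congrArg g.hom h0).trans (map_zero _))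
  · have h1 : I.cocomplex.d i (i + 1) (g (Submodule.Quotient.mk 1)) =
        φ (x ^ m • (Submodule.Quotient.mk 1 : R ⧸ a ^ j)) :=
      congr($hg (Submodule.Quotient.mk 1 : R ⧸ a ^ k))
    have h2 : φ (Submodule.Quotient.mk 1 : R ⧸ a ^ j) = z := one_smul R z
    exact h1.trans ((map_smul φ.hom _ _).trans (congrArg (x ^ m • ·) h2))

/-- Divides `w` by `x^k` inside the injective module `Γ_a(I^i)`, so the corrected cocycle is both
`a`-torsion and `x`-power torsion. -/
theorem exists_sub_d_mem_primaryComponent_sup [IsNoetherianRing R] {a : Ideal R} {x : R} {i : ℕ}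
    {M : ModuleCat.{u} R}
    (h : ExtPowTorsion a x (i + 1) M) (I : InjectiveResolution M) (z : I.cocomplex.X (i + 1))
    (hz : z ∈ a.primaryComponent (I.cocomplex.X (i + 1)))
    (hd : I.cocomplex.d (i + 1) (i + 2) z = 0) :
    ∃ w ∈ a.primaryComponent (I.cocomplex.X i), z - I.cocomplex.d i (i + 1) w ∈
        (a ⊔ Ideal.span {x}).primaryComponent (I.cocomplex.X (i + 1)) := by
  obtain ⟨k, w, hw, hdw⟩ := exists_pow_smul_eq_d h I z hz hd
  have : Module.Injective R (I.cocomplex.X i) :=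
    (Module.injective_iff_injective_object R _).2 (I.injective i)
  have := injective_primaryComponent (I := I.cocomplex.X i) a
  obtain ⟨⟨w', hw'⟩, m, hm⟩ := exists_pow_smul_sub_pow_smul_eq_zero x k
    (⟨w, hw⟩ : a.primaryComponent (I.cocomplex.X i))
  have hm' : x ^ m • (w - x ^ k • w') = 0 := congrArg Subtype.val hm
  refine ⟨w', hw', mem_primaryComponent_sup_span (k := m + k)
    (sub_mem hz (Ideal.primaryComponent_map_mem a (I.cocomplex.d i (i + 1)).hom ⟨w', hw'⟩)) ?_⟩
  rw [pow_add, mul_smul, smul_sub (x ^ k), ← hdw]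
  have := congrArg (I.cocomplex.d i (i + 1)).hom hm'
  rw [map_smul, map_sub, map_smul, map_zero] at this
  exact this

/-- A cocycle of `Γ_a(I)` in the degree of the dimension is cohomologous to one of
`Γ_{a ⊔ J}(I)`. -/
theorem exists_sub_d_mem_primaryComponent [IsNoetherianRing R] [IsLocalRing R]
    {M : Type u} [AddCommGroup M] [Module R M] [Module.Finite R M] {n : ℕ}
    (hn : Module.supportDim R M = n) (I : InjectiveResolution (ModuleCat.of R M))
    (a : Ideal R) {J : Ideal R} (hJ : J ≠ ⊤) (z : I.cocomplex.X n)
    (hz : z ∈ a.primaryComponent (I.cocomplex.X n))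
    (hd : I.cocomplex.d n (n + 1) z = 0) :
    ∃ w ∈ a.primaryComponent (I.cocomplex.X ((ComplexShape.up ℕ).prev n)),
      z - I.cocomplex.d ((ComplexShape.up ℕ).prev n) n w ∈
        (a ⊔ J).primaryComponent (I.cocomplex.X n) := by
  have hJfg : J.FG := IsNoetherian.noetherian J
  induction J, hJfg using Submodule.fg_induction generalizing a z with
  | singleton x =>
    have hx : x ∈ IsLocalRing.maximalIdeal R :=
      IsLocalRing.le_maximalIdeal hJ (Ideal.mem_span_singleton_self x)
    have hdim := krullDim_supportAway_lt hn hx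
    cases n with
    | zero =>
      obtain ⟨m, hm⟩ := exists_pow_smul_eq_zero_of_krullDim_supportAway_lt hdim
      -- In degree zero no correction is needed: `z` comes from `M`, which `x^m` kills.
      refine ⟨0, zero_mem _, ?_⟩
      rw [map_zero, sub_zero]
      obtain ⟨y, rfl⟩ := (ShortComplex.moduleCat_exact_iff _).1 I.exact₀ z hd
      refine mem_primaryComponent_sup_span (k := m) hz ?_
      exact (map_smul (I.ι.f 0).hom _ _).symm.trans
        ((congrArg (I.ι.f 0).hom (hm y)).trans (map_zero _))
    | succ n =>
      rw [CochainComplex.prev_nat_succ]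
      exact exists_sub_d_mem_primaryComponent_sup
        (extPowTorsion_of_krullDim_supportAway_lt a x (n + 1) M hdim (n + 1) le_rfl) I z hz hd
  | sup J₁ J₂ _ _ h₁ h₂ =>
    obtain ⟨w, hw, hzw⟩ := h₁ a (fun h => hJ (by rw [h, top_sup_eq])) z hz hd
    -- The corrected cocycle is already `(a + J₁)`-torsion, hence the generalization over `a`.
    obtain ⟨w', hw', hzw'⟩ := h₂ (a ⊔ J₁) (fun h => hJ (by rw [h, sup_top_eq])) _ hzw (by
      rw [map_sub, hd, zero_sub, neg_eq_zero, ← ConcreteCategory.comp_apply,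
        HomologicalComplex.d_comp_d]
      rfl)
    refine ⟨w + w', add_mem hw (primaryComponent_anti le_sup_left hw'), ?_⟩
    rwa [map_add, ← sub_sub, ← sup_assoc]

/-- A morphism of short complexes of modules is surjective on homology if every cycle is the sum of
the image of a cycle and a boundary. -/
theorem homologyMap_surjective {S₁ S₂ : ShortComplex (ModuleCat.{u} R)} (φ : S₁ ⟶ S₂)
    (h : ∀ z : S₂.X₂, S₂.g z = 0 → ∃ (y : S₁.X₂) (w : S₂.X₁), S₁.g y = 0 ∧ z = φ.τ₂ y + S₂.f w) :
    Function.Surjective (ShortComplex.homologyMap φ) := by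
  intro t
  obtain ⟨c, rfl⟩ := (ModuleCat.epi_iff_surjective S₂.homologyπ).1 inferInstance t
  obtain ⟨y, w, hy, hyw⟩ := h (S₂.iCycles c) (by
    rw [← ConcreteCategory.comp_apply, ShortComplex.iCycles_g]
    rfl)
  let e : S₁.cycles := S₁.moduleCatCyclesIso.inv ⟨y, hy⟩
  have he : S₁.iCycles e = y := congr($(S₁.moduleCatCyclesIso_inv_iCycles) ⟨y, hy⟩)
  have hc : c = ShortComplex.cyclesMap φ e + S₂.toCycles w := by
    apply (ModuleCat.mono_iff_injective S₂.iCycles).1 inferInstance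
    rw [map_add, ← ConcreteCategory.comp_apply, ← ConcreteCategory.comp_apply,
      ShortComplex.cyclesMap_i, ShortComplex.toCycles_i, ConcreteCategory.comp_apply, he, hyw]
  refine ⟨S₁.homologyπ e, ?_⟩
  rw [hc, map_add, ← ConcreteCategory.comp_apply, ← ConcreteCategory.comp_apply,
    ← ConcreteCategory.comp_apply, ShortComplex.homologyπ_naturality,
    ShortComplex.toCycles_comp_homologyπ]
  exact (add_zero _).symm

theorem coe_primaryComponent_map (a : Ideal R) {N P : Type*} [AddCommGroup N] [Module R N]
    [AddCommGroup P] [Module R P] (f : N →ₗ[R] P) (x : a.primaryComponent N) :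
    (Ideal.primaryComponent.map a f x : P) = f x := by
  unfold Ideal.primaryComponent.map
  rw [LinearMap.codRestrict_apply, LinearMap.domRestrict_apply]

theorem inclusion_comp_map {a b : Ideal R} (h : a ≤ b) {N P : Type*} [AddCommGroup N] [Module R N]
    [AddCommGroup P] [Module R P] (f : N →ₗ[R] P) :
    Submodule.inclusion (primaryComponent_anti (M := P) h) ∘ₗ Ideal.primaryComponent.map b f =
      Ideal.primaryComponent.map a f ∘ₗ Submodule.inclusion (primaryComponent_anti h) := by
  ext x
  rw [LinearMap.comp_apply, LinearMap.comp_apply, Submodule.coe_inclusion,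
    coe_primaryComponent_map, coe_primaryComponent_map, Submodule.coe_inclusion]

/-- The inclusion `Γ_b ⟶ Γ_a` for `a ≤ b`. -/
def torsionInclusion {a b : Ideal R} (h : a ≤ b) :
    torsionFunctor b ⟶ torsionFunctor a where
  app _ := ModuleCat.ofHom (Submodule.inclusion (primaryComponent_anti h))
  naturality _ _ f := congrArg ModuleCat.ofHom (inclusion_comp_map h f.hom)

theorem coe_torsionFunctor_map (a : Ideal R) {N P : ModuleCat.{u} R} (f : N ⟶ P)
    (x : a.primaryComponent N) :
    Subtype.val (p := (· ∈ a.primaryComponent P)) ((torsionFunctor a).map f x) = f x.1 :=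
  coe_primaryComponent_map a f.hom x

theorem coe_torsionInclusion_app {a b : Ideal R} (h : a ≤ b) {N : ModuleCat.{u} R}
    (x : b.primaryComponent N) :
    Subtype.val (p := (· ∈ a.primaryComponent N)) ((torsionInclusion h).app N x) = x.1 :=
  Submodule.coe_inclusion (primaryComponent_anti h) x

theorem rightDerived_torsionInclusion_surjective [IsNoetherianRing R] [IsLocalRing R]
    {M : Type u} [AddCommGroup M] [Module R M] [Module.Finite R M] {n : ℕ}
    (hn : Module.supportDim R M = n) {a b : Ideal R} (hb : b ≠ ⊤) (hab : a ≤ b) :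
    Function.Surjective
      ((NatTrans.rightDerived (torsionInclusion hab) n).app (ModuleCat.of R M)) := by
  let I := injectiveResolution (ModuleCat.of R M)
  rw [← ModuleCat.epi_iff_surjective, I.rightDerived_app_eq]
  suffices Epi ((HomologicalComplex.homologyFunctor (ModuleCat.{u} R) (ComplexShape.up ℕ) n).map
      ((NatTrans.mapHomologicalComplex (torsionInclusion hab) _).app I.cocomplex)) by infer_instance
  rw [ModuleCat.epi_iff_surjective]
  refine homologyMap_surjective _ fun z hz => ?_
  change a.primaryComponent (I.cocomplex.X n) at z
  have hd : I.cocomplex.d n ((ComplexShape.up ℕ).next n) z.1 = 0 :=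
    (coe_torsionFunctor_map a _ z).symm.trans (congrArg Subtype.val hz)
  rw [CochainComplex.next] at hd
  obtain ⟨w, hw, hzw⟩ := exists_sub_d_mem_primaryComponent hn I a hb z.1 z.2 hd
  rw [sup_eq_right.2 hab] at hzw
  refine ⟨⟨_, hzw⟩, ⟨w, hw⟩, ?_, ?_⟩
  · apply Subtype.ext
    refine (coe_torsionFunctor_map b _ _).trans ?_
    change I.cocomplex.d n ((ComplexShape.up ℕ).next n) (z.1 - _) = 0
    rw [CochainComplex.next, map_sub, hd, zero_sub, neg_eq_zero, ← ConcreteCategory.comp_apply,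
      HomologicalComplex.d_comp_d]
    rfl
  · apply Subtype.ext
    refine (sub_add_cancel z.1 (I.cocomplex.d _ n w)).symm.trans ?_
    exact congrArg₂ (· + ·) (coe_torsionInclusion_app hab ⟨_, hzw⟩).symm
      (coe_torsionFunctor_map a (I.cocomplex.d _ n) ⟨w, hw⟩).symm

end Resolution
end TopLocalCohomology

theorem theorem1p5 {R : Type u} [CommRing R] [IsLocalRing R] [IsNoetherianRing R]
    (M : Type u) [AddCommGroup M] [Module R M] [Module.Finite R M]
    (n : ℕ) (hn : Module.supportDim R M = n)
    (a b : Ideal R) (hb : b ≠ ⊤) (hab : a ≤ b) :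
    ∃ f : TopLocalCohomology.H b n M →ₗ[R] TopLocalCohomology.H a n M,
      Function.Surjective f :=
  ⟨_, TopLocalCohomology.rightDerived_torsionInclusion_surjective hn hb hab⟩
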